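/- Let $m\ge 1$, let $M_1,\dots,M_m$ be closed linear subspaces of a real Hilbert space $\mathcal H$, and put $M:=\bigcap_{i=1}^m M_i$. Write $P_K$ for the orthogonal projection onto a closed subspace $K$ and put $T:=P_{M_m}\cdots P_{M_1}$. Let $\mathbf H:=\mathcal H^m$ carry the inner product $\langle \mathbf x,\mathbf y\rangle=\frac1m\sum_{i=1}^m\langle x_i,y_i\rangle$, and put $\mathbf C:=M_1\times\cdots\times M_m$, $\mathbf D:=\{(x,\dots,x):x\in\mathcal H\}$, $\mathbf M_i:=M_i\times\cdots\times M_i$ ($m$ factors) and $\mathbf T:=P_{\mathbf M_m}\cdots P_{\mathbf M_1}$. All norms below are operator norms and all rates are for $k\to\infty$. Then $\sum_{i=1}^m M_i^\perp$ is closed if and only if $\|T-P_M\|<1$. Moreover, let $\varepsilon>0$ and assume that at least one of the following conditions holds: (i) $\|T^k-T^{k-1}\|=\mathcal O(k^{-1-\varepsilon})$; (ii) $\max_{i}\|P_{M_i^\perp}T^k\|=\mathcal O(k^{-1/2-\varepsilon})$; (iii) $\max_{i}\|T^kP_{M_i^\perp}\|=\mathcal O(k^{-1/2-\varepsilon})$;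 (iv) $\max_{i}\|(T^k-T^{k-1})P_{M_i^\perp}\|=\mathcal O(k^{-3/2-\varepsilon})$; (v) $\max_{i,j}\|P_{M_i^\perp}T^kP_{M_j^\perp}\|=\mathcal O(k^{-1-\varepsilon})$; (vi) $\|(\mathbf T^k-\mathbf T^{k-1})P_{\mathbf D}\|=\mathcal O(k^{-1-\varepsilon})$; (vii) $\|P_{\mathbf C^\perp}\mathbf T^kP_{\mathbf D}\|=\mathcal O(k^{-1/2-\varepsilon})$; (viii) $\|\mathbf T^kP_{\mathbf D}P_{\mathbf C^\perp}\|=\mathcal O(k^{-1/2-\varepsilon})$; (ix) $\|(\mathbf T^k-\mathbf T^{k-1})P_{\mathbf D}P_{\mathbf C^\perp}\|=\mathcal O(k^{-3/2-\varepsilon})$; (x) $\|P_{\mathbf C^\perp}\mathbf T^kP_{\mathbf D}P_{\mathbf C^\perp}\|=\mathcal O(k^{-1-\varepsilon})$. Then $\sum_{i=1}^m M_i^\perp$ is closed (equivalently, $\|T-P_M\|<1$), and there is a $q\in(0,1)$ such that all ten sequences of norms in (i)--(x) are $\mathcal O(q^k)$. -/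

import Mathlib

open Filter Asymptotics

/-- The product space `H × ⋯ × H` (`m` factors), kept apart from the Pi type `Fin m → H`, which
carries the sup norm. Its inner product is `⟪x, y⟫ = (1 / m) ∑ i, ⟪x i, y i⟫`, and its norm is the
induced one, `‖x‖ = √((1 / m) ∑ i, ‖x i‖²)`. -/
@[ext]
structure ProductSpace (H : Type*) (m : ℕ) where
  coord : Fin m → H

/-- The operator `P_{M_m} ⋯ P_{M_1}` (first `P_{M_1}`, last `P_{M_m}`), where `P_K` is the
orthogonal projection onto `K`. -/
noncomputable def cyclicProjection {E : Type*} [NormedAddCommGroup E] [InnerProductSpace ℝ E]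
    {m : ℕ} (M : Fin m → Submodule ℝ E) [∀ i, (M i).HasOrthogonalProjection] : E →L[ℝ] E :=
  (List.ofFn fun i => (M i).starProjection).reverse.prod

namespace ProductSpace

instance instCoeFun {H : Type*} {m : ℕ} : CoeFun (ProductSpace H m) fun _ => Fin m → H :=
  ⟨coord⟩

/-- A point of the product space is an `m`-tuple of points of `H`. -/
def equivFun (H : Type*) (m : ℕ) : ProductSpace H m ≃ (Fin m → H) where
  toFun := coord
  invFun := mk
  left_inv _ := rfl
  right_inv _ := rfl

instance instAddCommGroup {H : Type*} [AddCommGroup H] {m : ℕ} :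
    AddCommGroup (ProductSpace H m) :=
  (equivFun H m).addCommGroup

instance instModule {H : Type*} [AddCommGroup H] [Module ℝ H] {m : ℕ} :
    Module ℝ (ProductSpace H m) :=
  (equivFun H m).module ℝ

theorem add_apply {H : Type*} [AddCommGroup H] {m : ℕ} (x y : ProductSpace H m) (i : Fin m) :
    (x + y) i = x i + y i := rfl

theorem sub_apply {H : Type*} [AddCommGroup H] {m : ℕ} (x y : ProductSpace H m) (i : Fin m) :
    (x - y) i = x i - y i := rfl

theorem smul_apply {H : Type*} [AddCommGroup H] [Module ℝ H] {m : ℕ} (r : ℝ)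
    (x : ProductSpace H m) (i : Fin m) : (r • x) i = r • x i := rfl

theorem zero_apply {H : Type*} [AddCommGroup H] {m : ℕ} (i : Fin m) :
    (0 : ProductSpace H m) i = 0 := rfl

section Structure

variable {H : Type*} [NormedAddCommGroup H] [InnerProductSpace ℝ H] {m : ℕ}

/-- The inner product `⟪x, y⟫ = (1 / m) ∑ i, ⟪x i, y i⟫`. -/
@[reducible]
noncomputable def core : InnerProductSpace.Core ℝ (ProductSpace H m) where
  inner x y := (1 / (m : ℝ)) * ∑ i, inner ℝ (x i) (y i)
  conj_inner_symm x y := by simp [real_inner_comm]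
  re_inner_nonneg x := by
    simp only [RCLike.re_to_real]
    exact mul_nonneg (by positivity) (Finset.sum_nonneg fun i _ => real_inner_self_nonneg)
  add_left x y z := by
    simp only [add_apply, inner_add_left, Finset.sum_add_distrib, mul_add]
  smul_left x y r := by
    simp only [smul_apply, real_inner_smul_left, ← Finset.mul_sum, conj_trivial]
    ring
  definite x hx := by
    ext i
    have hm : (1 / (m : ℝ)) ≠ 0 := by
      have : 0 < m := i.pos
      positivity
    have hs : ∑ i, inner ℝ (x i) (x i) = 0 := (mul_eq_zero.mp hx).resolve_left hm
    have := (Finset.sum_eq_zero_iff_of_nonneg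
      (fun i _ => real_inner_self_nonneg (x := x i))).mp hs i (Finset.mem_univ i)
    exact inner_self_eq_zero.mp this

noncomputable instance instNormedAddCommGroup : NormedAddCommGroup (ProductSpace H m) :=
  @InnerProductSpace.Core.toNormedAddCommGroup ℝ _ _ _ _ core

noncomputable instance instInnerProductSpace : InnerProductSpace ℝ (ProductSpace H m) :=
  InnerProductSpace.ofCore core.toCore

theorem inner_def (x y : ProductSpace H m) :
    inner ℝ x y = (1 / (m : ℝ)) * ∑ i, inner ℝ (x i) (y i) := rfl

theorem norm_def (x : ProductSpace H m) : ‖x‖ = √((1 / (m : ℝ)) * ∑ i, ‖x i‖ ^ 2) := by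
  rw [norm_eq_sqrt_real_inner, inner_def]
  simp only [real_inner_self_eq_norm_sq]

/-- The subspace `K 1 × ⋯ × K m` of the product space. -/
def pi (K : Fin m → Submodule ℝ H) : Submodule ℝ (ProductSpace H m) where
  carrier := {x | ∀ i, x i ∈ K i}
  add_mem' hx hy i := (K i).add_mem (hx i) (hy i)
  zero_mem' i := (K i).zero_mem
  smul_mem' r _ hx i := (K i).smul_mem r (hx i)

variable (H m) in
/-- The diagonal `{(x, …, x) | x ∈ H}` of the product space. -/
def diagonal : Submodule ℝ (ProductSpace H m) where
  carrier := {x | ∃ h : H, x = ⟨fun _ => h⟩}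
  add_mem' := by
    rintro _ _ ⟨a, rfl⟩ ⟨b, rfl⟩
    exact ⟨a + b, rfl⟩
  zero_mem' := ⟨0, rfl⟩
  smul_mem' := by
    rintro r _ ⟨a, rfl⟩
    exact ⟨r • a, rfl⟩

instance instHasOrthogonalProjectionPi (K : Fin m → Submodule ℝ H)
    [∀ i, (K i).HasOrthogonalProjection] : (pi K).HasOrthogonalProjection where
  exists_orthogonal v := by
    refine ⟨⟨fun i => (K i).starProjection (v i)⟩, fun i => (K i).starProjection_apply_mem _, ?_⟩
    rw [Submodule.mem_orthogonal']
    intro u hu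
    rw [inner_def, Finset.sum_eq_zero, mul_zero]
    intro i _
    exact (K i).starProjection_inner_eq_zero (v i) (u i) (hu i)

instance instHasOrthogonalProjectionDiagonal : (diagonal H m).HasOrthogonalProjection where
  exists_orthogonal v := by
    refine ⟨⟨fun _ => (1 / (m : ℝ)) • ∑ i, v i⟩, ⟨_, rfl⟩, ?_⟩
    rw [Submodule.mem_orthogonal']
    rintro _ ⟨a, rfl⟩
    rw [inner_def]
    rcases Nat.eq_zero_or_pos m with rfl | hm
    · simp
    · have hm' : (m : ℝ) ≠ 0 := by positivity
      simp only [sub_apply, inner_sub_left, Finset.sum_sub_distrib, real_inner_smul_left,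
        sum_inner, Finset.sum_const, Finset.card_univ, Fintype.card_fin, nsmul_eq_mul]
      field_simp
      simp

end Structure

end ProductSpace

/-! Write `N` for the intersection, `S` for the sum of the complements and call `‖x‖² - ‖T x‖²` the
energy lost in one cycle. By Pythagoras it is the sum of the squared steps of the cycle, so up to
constants it equals the square of the largest distance from `x` to a subspace.

Each rate forces `T ^ k → P_N` in operator norm. A rate on differences is summed directly; a rate
with a complementary projection on the left bounds the energy losses, which are summed and then
rooted. Both sums start from the strong limit `T ^ k x → 0` on `Nᗮ`. Projections on the right are
handled by taking adjoints, since `T*` is the product in reverse order. The two-sided rates and the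
rates on differences followed by a complementary projection reduce to that case.

Once `‖T ^ n - P_N‖ < 1`, a Neumann series writes each `y ∈ Nᗮ` as `x - T ^ n x`, which telescopes
into `S`; so `S = Nᗮ` is closed (`isClosed_of_norm_pow_sub_lt_one`). Conversely, closedness gives
linear regularity by the open mapping theorem (`exists_norm_le_of_isClosed_iSup`), so every cycle
loses a fixed fraction of the energy on `Nᗮ` and `‖T - P_N‖ < 1` (`norm_projProd_sub_lt_one`). All
rates are then geometric. The product-space conditions are the same conditions up to bounded
factors. -/

section ProjectionProducts

/-! ### Products of projections and the energy lost in a cycle. -/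

variable {H : Type*} [NormedAddCommGroup H] [InnerProductSpace ℝ H] [CompleteSpace H]

/-- The orthogonal projection onto a closed subspace. -/
noncomputable abbrev proj (K : ClosedSubmodule ℝ H) : H →L[ℝ] H := K.toSubmodule.starProjection

/-- The orthogonal projection onto the orthogonal complement of a closed subspace. -/
noncomputable abbrev coproj (K : ClosedSubmodule ℝ H) : H →L[ℝ] H :=
  K.toSubmoduleᗮ.starProjection

/-- The product of the projections onto the members of a list, the head acting first. -/
noncomputable def projProd (l : List (ClosedSubmodule ℝ H)) : H →L[ℝ] H :=
  (l.map proj).reverse.prod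

theorem projProd_nil : projProd ([] : List (ClosedSubmodule ℝ H)) = 1 := rfl

theorem projProd_cons (K : ClosedSubmodule ℝ H) (l : List (ClosedSubmodule ℝ H)) :
    projProd (K :: l) = projProd l * proj K := by
  simp [projProd]

theorem projProd_cons_apply (K : ClosedSubmodule ℝ H) (l : List (ClosedSubmodule ℝ H)) (x : H) :
    projProd (K :: l) x = projProd l (proj K x) := by
  rw [projProd_cons]; rfl

theorem coproj_apply (K : ClosedSubmodule ℝ H) (x : H) : coproj K x = x - proj K x := by
  rw [coproj, Submodule.starProjection_orthogonal_val]

theorem coproj_mem (K : ClosedSubmodule ℝ H) (x : H) : coproj K x ∈ K.toSubmoduleᗮ :=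
  Submodule.starProjection_apply_mem _ _

theorem norm_coproj_apply_le (K : ClosedSubmodule ℝ H) (x : H) : ‖coproj K x‖ ≤ ‖x‖ :=
  Submodule.norm_starProjection_apply_le _ _

theorem norm_sq_eq_proj_add_coproj (K : ClosedSubmodule ℝ H) (x : H) :
    ‖x‖ ^ 2 = ‖proj K x‖ ^ 2 + ‖coproj K x‖ ^ 2 :=
  Submodule.norm_sq_eq_add_norm_sq_starProjection x K.toSubmodule

theorem coproj_eq_zero_iff (K : ClosedSubmodule ℝ H) (x : H) : coproj K x = 0 ↔ x ∈ K := by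
  rw [coproj_apply, sub_eq_zero, eq_comm, proj, Submodule.starProjection_eq_self_iff]
  exact K.mem_toSubmodule_iff x

theorem proj_of_mem {K : ClosedSubmodule ℝ H} {x : H} (hx : x ∈ K) : proj K x = x :=
  Submodule.starProjection_eq_self_iff.mpr hx

theorem norm_projProd_apply_le (l : List (ClosedSubmodule ℝ H)) (x : H) :
    ‖projProd l x‖ ≤ ‖x‖ := by
  induction l generalizing x with
  | nil => rfl
  | cons K l ih =>
    rw [projProd_cons_apply]
    exact (ih _).trans (Submodule.norm_starProjection_apply_le _ _)

theorem norm_projProd_pow_apply_le (l : List (ClosedSubmodule ℝ H)) (n : ℕ) (x : H) :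
    ‖(projProd l ^ n) x‖ ≤ ‖x‖ := by
  induction n with
  | zero => rfl
  | succ n ih =>
    rw [pow_succ']
    exact (norm_projProd_apply_le l _).trans ih

theorem projProd_apply_of_mem {l : List (ClosedSubmodule ℝ H)} {x : H} (hx : ∀ K ∈ l, x ∈ K) :
    projProd l x = x := by
  induction l with
  | nil => rfl
  | cons K l ih =>
    rw [projProd_cons_apply, proj_of_mem (hx K (by simp))]
    exact ih fun J hJ => hx J (by simp [hJ])

/-- The reversed list has the same intersection, so whatever is proved for all lists also holds for
the adjoint. -/
theorem adjoint_projProd (l : List (ClosedSubmodule ℝ H)) :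
    star (projProd l) = projProd l.reverse := by
  have h : ∀ L : List (H →L[ℝ] H), star L.prod = (L.map star).reverse.prod := by
    intro L
    induction L with
    | nil => simp
    | cons a L ih => simp [ih]
  have hs : ∀ K : ClosedSubmodule ℝ H, star (proj K) = proj K := fun K =>
    (isSelfAdjoint_starProjection K.toSubmodule).star_eq
  rw [projProd, projProd, h]
  simp only [List.map_reverse, List.map_map, List.reverse_reverse]
  congr 1
  exact List.map_congr_left fun K _ => hs K

/-- The energy lost along `J :: l` is `‖coproj J x‖²` plus the loss along `l` from `proj J x`.
Moving from `x` to `proj J x` changes `coproj K` by at most `‖coproj J x‖`; squaring the sum of two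
terms costs the factor 2. -/
theorem norm_coproj_sq_le_energy (l : List (ClosedSubmodule ℝ H)) :
    ∃ c : ℝ, 0 ≤ c ∧ ∀ K ∈ l, ∀ x, ‖coproj K x‖ ^ 2 ≤ c * (‖x‖ ^ 2 - ‖projProd l x‖ ^ 2) := by
  induction l with
  | nil => exact ⟨0, le_rfl, by simp⟩
  | cons J l ih =>
    obtain ⟨c, hc, h⟩ := ih
    refine ⟨2 * c + 2, by positivity, fun K hK x => ?_⟩
    have h1 := norm_sq_eq_proj_add_coproj J x
    have h2 := norm_projProd_apply_le l (proj J x)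
    have h3 : ‖projProd l (proj J x)‖ ^ 2 ≤ ‖proj J x‖ ^ 2 := by gcongr
    have h4 := sq_nonneg ‖coproj J x‖
    rw [projProd_cons_apply]
    have h5 : 0 ≤ c * ‖coproj J x‖ ^ 2 := by positivity
    have h6 : 0 ≤ c * (‖proj J x‖ ^ 2 - ‖projProd l (proj J x)‖ ^ 2) :=
      mul_nonneg hc (by linarith)
    rcases List.mem_cons.mp hK with rfl | hK
    · nlinarith
    · have h7 := h K hK (proj J x)
      have h8 : ‖coproj K x‖ ≤ ‖coproj K (proj J x)‖ + ‖coproj J x‖ := by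
        have : coproj K x = coproj K (proj J x) + coproj K (coproj J x) := by
          rw [← map_add, coproj_apply J]; simp
        rw [this]
        exact (norm_add_le _ _).trans (by gcongr; exact norm_coproj_apply_le _ _)
      have h9 : ‖coproj K x‖ ^ 2 ≤ 2 * ‖coproj K (proj J x)‖ ^ 2 + 2 * ‖coproj J x‖ ^ 2 := by
        nlinarith [sq_nonneg (‖coproj K (proj J x)‖ - ‖coproj J x‖), norm_nonneg (coproj K x)]
      nlinarith

theorem energy_le_of_norm_coproj_le (l : List (ClosedSubmodule ℝ H)) :
    ∃ c : ℝ, 0 ≤ c ∧ ∀ x, ∀ δ : ℝ, (∀ K ∈ l, ‖coproj K x‖ ≤ δ) →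
      ‖x‖ ^ 2 - ‖projProd l x‖ ^ 2 ≤ c * δ ^ 2 := by
  induction l with
  | nil => exact ⟨0, le_rfl, by simp [projProd_nil]⟩
  | cons J l ih =>
    obtain ⟨c, hc, h⟩ := ih
    refine ⟨1 + 4 * c, by positivity, fun x δ hδ => ?_⟩
    have hJ := hδ J (by simp)
    have h1 := norm_sq_eq_proj_add_coproj J x
    -- After the first projection the bound `δ` worsens to `2δ`, whence `4 * c`.
    have h2 := h (proj J x) (2 * δ) fun K hK => by
      have : coproj K (proj J x) = coproj K x - coproj K (coproj J x) := by
        rw [← map_sub, coproj_apply J]; simp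
      rw [this]
      have h3 := norm_sub_le (coproj K x) (coproj K (coproj J x))
      have h4 := norm_coproj_apply_le K (coproj J x)
      have h5 := hδ K (by simp [hK])
      linarith
    have h3 : ‖coproj J x‖ ^ 2 ≤ δ ^ 2 := by gcongr
    rw [projProd_cons_apply]
    linarith

theorem norm_sub_projProd_sq_le_energy (l : List (ClosedSubmodule ℝ H)) :
    ∃ c : ℝ, 0 ≤ c ∧ ∀ x, ‖x - projProd l x‖ ^ 2 ≤ c * (‖x‖ ^ 2 - ‖projProd l x‖ ^ 2) := by
  induction l with
  | nil => exact ⟨0, le_rfl, by simp [projProd_nil]⟩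
  | cons J l ih =>
    obtain ⟨c, hc, h⟩ := ih
    refine ⟨2 * c + 2, by positivity, fun x => ?_⟩
    have h1 := norm_sq_eq_proj_add_coproj J x
    have h2 := norm_projProd_apply_le l (proj J x)
    have h3 : ‖projProd l (proj J x)‖ ^ 2 ≤ ‖proj J x‖ ^ 2 := by gcongr
    have h5 : 0 ≤ c * ‖coproj J x‖ ^ 2 := by positivity
    have h7 := h (proj J x)
    rw [projProd_cons_apply]
    have h8 : ‖x - projProd l (proj J x)‖ ≤
        ‖proj J x - projProd l (proj J x)‖ + ‖coproj J x‖ := by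
      have : x - projProd l (proj J x) = (proj J x - projProd l (proj J x)) + coproj J x := by
        rw [coproj_apply J]; abel
      rw [this]
      exact norm_add_le _ _
    have h9 : ‖x - projProd l (proj J x)‖ ^ 2 ≤
        2 * ‖proj J x - projProd l (proj J x)‖ ^ 2 + 2 * ‖coproj J x‖ ^ 2 := by
      nlinarith [sq_nonneg (‖proj J x - projProd l (proj J x)‖ - ‖coproj J x‖),
        norm_nonneg (x - projProd l (proj J x))]
    nlinarith

theorem sub_projProd_mem {l : List (ClosedSubmodule ℝ H)} {S : Submodule ℝ H}
    (hS : ∀ K ∈ l, K.toSubmoduleᗮ ≤ S) (x : H) : x - projProd l x ∈ S := by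
  induction l generalizing x with
  | nil => simp [projProd_nil]
  | cons J l ih =>
    have : x - projProd (J :: l) x = coproj J x + (proj J x - projProd l (proj J x)) := by
      rw [coproj_apply J, projProd_cons_apply]; abel
    rw [this]
    exact S.add_mem (hS J (by simp) (coproj_mem J x)) (ih (fun K hK => hS K (by simp [hK])) _)

/-- Every single projection moves a point by a vector of some `Kᗮ`. This puts the range of `1 - T ^
n` inside the sum of the complements even when that sum is not closed. -/
theorem sub_projProd_pow_mem {l : List (ClosedSubmodule ℝ H)} {S : Submodule ℝ H}
    (hS : ∀ K ∈ l, K.toSubmoduleᗮ ≤ S) (n : ℕ) (x : H) : x - (projProd l ^ n) x ∈ S := by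
  induction n with
  | zero => simp
  | succ n ih =>
    have : x - (projProd l ^ (n + 1)) x =
        (x - (projProd l ^ n) x) + ((projProd l ^ n) x - projProd l ((projProd l ^ n) x)) := by
      rw [pow_succ']; simp
    rw [this]
    exact S.add_mem ih (sub_projProd_mem hS _)

/-- A fixed point loses no energy, so all its distances to the subspaces vanish. -/
theorem mem_of_projProd_eq_self {l : List (ClosedSubmodule ℝ H)} {x : H}
    (hx : projProd l x = x) : ∀ K ∈ l, x ∈ K := by
  intro K hK
  obtain ⟨c, -, h⟩ := norm_coproj_sq_le_energy l
  have := h K hK x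
  rw [hx, sub_self, mul_zero] at this
  rw [← coproj_eq_zero_iff, ← norm_eq_zero]
  exact pow_eq_zero_iff two_ne_zero |>.mp (le_antisymm this (sq_nonneg _))

/-! ### Powers of the product relative to the intersection, and their strong convergence. -/

variable {l : List (ClosedSubmodule ℝ H)} {N : ClosedSubmodule ℝ H}

theorem projProd_mul_proj (hN : ∀ x, x ∈ N ↔ ∀ K ∈ l, x ∈ K) :
    projProd l * proj N = proj N := by
  ext x
  exact projProd_apply_of_mem ((hN _).mp (N.toSubmodule.starProjection_apply_mem x))

theorem proj_mul_projProd (hN : ∀ x, x ∈ N ↔ ∀ K ∈ l, x ∈ K) :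
    proj N * projProd l = proj N := by
  have h := projProd_mul_proj (l := l.reverse) (N := N) (by simpa using hN)
  have h2 := congrArg star h
  rwa [star_mul, adjoint_projProd, List.reverse_reverse,
    (isSelfAdjoint_starProjection N.toSubmodule).star_eq] at h2

theorem coproj_eq (K : ClosedSubmodule ℝ H) : coproj K = 1 - proj K := by
  ext x; exact coproj_apply K x

theorem pow_mul_proj (hN : ∀ x, x ∈ N ↔ ∀ K ∈ l, x ∈ K) (n : ℕ) :
    projProd l ^ n * proj N = proj N := by
  induction n with
  | zero => simp
  | succ n ih => rw [pow_succ, mul_assoc, projProd_mul_proj hN, ih]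

theorem pow_mul_coproj (hN : ∀ x, x ∈ N ↔ ∀ K ∈ l, x ∈ K) (n : ℕ) :
    projProd l ^ n * coproj N = projProd l ^ n - proj N := by
  rw [coproj_eq, mul_sub, mul_one, pow_mul_proj hN]

theorem commute_projProd_coproj (hN : ∀ x, x ∈ N ↔ ∀ K ∈ l, x ∈ K) :
    Commute (projProd l) (coproj N) := by
  rw [coproj_eq, Commute, SemiconjBy, mul_sub, sub_mul, projProd_mul_proj hN,
    proj_mul_projProd hN, mul_one, one_mul]

theorem coproj_mul_coproj (K : ClosedSubmodule ℝ H) : coproj K * coproj K = coproj K :=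
  K.toSubmoduleᗮ.isIdempotentElem_starProjection

/-- `coproj N` is idempotent and commutes with `T`, so it can be inserted between all factors of `T
^ n`, each becoming `T - P_N`. -/
theorem norm_pow_mul_coproj_le (hN : ∀ x, x ∈ N ↔ ∀ K ∈ l, x ∈ K) (n : ℕ) :
    ‖projProd l ^ n * coproj N‖ ≤ ‖projProd l - proj N‖ ^ n := by
  induction n with
  | zero => simpa using N.toSubmoduleᗮ.starProjection_norm_le
  | succ n ih =>
    have : projProd l ^ (n + 1) * coproj N =
        (projProd l ^ n * coproj N) * (projProd l - proj N) := by
      rw [← pow_one (projProd l), ← pow_mul_coproj hN 1, pow_one, pow_succ, mul_assoc, mul_assoc,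
        (commute_projProd_coproj hN).eq, ← mul_assoc (coproj N), coproj_mul_coproj]
    rw [this, pow_succ]
    exact (norm_mul_le _ _).trans (by gcongr)

/-- The energies `‖T ^ n z‖²` decrease to a limit, so the loss per cycle tends to 0, and it
dominates the squared displacement. -/
theorem tendsto_projProd_pow_sub (l : List (ClosedSubmodule ℝ H)) (z : H) :
    Tendsto (fun n => (projProd l ^ n) (z - projProd l z)) atTop (nhds 0) := by
  obtain ⟨c, hc, h⟩ := norm_sub_projProd_sq_le_energy l
  set e : ℕ → ℝ := fun n => ‖(projProd l ^ n) z‖ ^ 2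
  have hsucc : ∀ n, (projProd l ^ (n + 1)) z = projProd l ((projProd l ^ n) z) := fun n => by
    rw [pow_succ']; rfl
  have hanti : Antitone e := antitone_nat_of_succ_le fun n => by
    simp only [e, hsucc]
    gcongr
    exact norm_projProd_apply_le l _
  have hlim := tendsto_atTop_ciInf hanti ⟨0, by rintro _ ⟨n, rfl⟩; positivity⟩
  have hdiff : Tendsto (fun n => c * (e n - e (n + 1))) atTop (nhds 0) := by
    have := (hlim.sub (hlim.comp (tendsto_add_atTop_nat 1))).const_mul c
    simpa using this
  have hsq : Tendsto (fun n => ‖(projProd l ^ n) (z - projProd l z)‖ ^ 2) atTop (nhds 0) := by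
    refine squeeze_zero (fun n => by positivity) (fun n => ?_) hdiff
    have : (projProd l ^ n) (z - projProd l z) =
        (projProd l ^ n) z - projProd l ((projProd l ^ n) z) := by
      rw [map_sub, ← hsucc, pow_succ]; rfl
    rw [this]
    simp only [e, hsucc]
    exact h _
  rw [tendsto_zero_iff_norm_tendsto_zero]
  simpa using hsq.sqrt

/-- The limit is known on the range of `1 - T`. That range is dense in `Nᗮ`, because a vector
orthogonal to it is fixed by `T*`, hence lies in `N`. Nonexpansiveness of the powers carries the
limit to the closure. -/
theorem tendsto_projProd_pow_of_mem_orthogonal (hN : ∀ x, x ∈ N ↔ ∀ K ∈ l, x ∈ K) {x : H}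
    (hx : x ∈ N.toSubmoduleᗮ) : Tendsto (fun n => (projProd l ^ n) x) atTop (nhds 0) := by
  have hcl : x ∈ closure (Set.range fun z => z - projProd l z) := by
    set R : Submodule ℝ H := LinearMap.range (1 - projProd l : H →L[ℝ] H).toLinearMap
    have hR : Rᗮ ≤ N.toSubmodule := by
      intro y hy
      have hy' : projProd l.reverse y = y := by
        rw [← adjoint_projProd]
        have : ∀ z, inner ℝ z (y - star (projProd l) y) = 0 := fun z => by
          rw [inner_sub_right, ContinuousLinearMap.star_eq_adjoint,
            ContinuousLinearMap.adjoint_inner_right, ← inner_sub_left]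
          exact hy _ ⟨z, rfl⟩
        exact (sub_eq_zero.mp (inner_self_eq_zero.mp (this _))).symm
      exact (hN y).mpr fun K hK => mem_of_projProd_eq_self hy' K (by simpa using hK)
    have := Submodule.orthogonal_le hR hx
    rw [Submodule.orthogonal_orthogonal_eq_closure] at this
    exact this
  rw [Metric.tendsto_atTop]
  intro ε hε
  obtain ⟨_, ⟨z, rfl⟩, hz⟩ := Metric.mem_closure_iff.mp hcl (ε / 2) (by positivity)
  obtain ⟨n₀, hn₀⟩ := Metric.tendsto_atTop.mp (tendsto_projProd_pow_sub l z) (ε / 2) (by positivity)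
  refine ⟨n₀, fun n hn => ?_⟩
  have h1 := hn₀ n hn
  rw [dist_zero_right] at h1 ⊢
  rw [dist_eq_norm] at hz
  have h2 := norm_projProd_pow_apply_le l n (x - (z - projProd l z))
  have h3 : (projProd l ^ n) x =
      (projProd l ^ n) (x - (z - projProd l z)) + (projProd l ^ n) (z - projProd l z) := by
    rw [← map_add, sub_add_cancel]
  rw [h3]
  refine (norm_add_le _ _).trans_lt ?_
  linarith

end ProjectionProducts

/-! ### Summation of polynomial rates. -/

/-- A Bernoulli-type bound for `((x + 1) / x) ^ δ`, from `exp u ≥ 1 + u` and `log u ≥ 1 - 1 / u`;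
the power of 2 comes from `x + 1 ≤ 2 * x`. It lets `n ^ (-δ)` stand in for the tail of the series of
`n ^ (-1 - δ)`. -/
theorem rpow_neg_sub_rpow_neg_ge {δ : ℝ} (hδ : 0 < δ) {x : ℝ} (hx : 1 ≤ x) :
    δ * 2 ^ (-1 - δ) * x ^ (-1 - δ) ≤ x ^ (-δ) - (x + 1) ^ (-δ) := by
  have hx0 : 0 < x := by linarith
  have h1 : x ^ (-δ) = (x + 1) ^ (-δ) * ((x + 1) / x) ^ δ := by
    rw [Real.div_rpow (by positivity) hx0.le, Real.rpow_neg (by positivity),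
      Real.rpow_neg (by positivity)]
    field_simp
  have h2 : 1 + δ / (x + 1) ≤ ((x + 1) / x) ^ δ := by
    rw [Real.rpow_def_of_pos (by positivity)]
    have h3 := Real.one_sub_inv_le_log_of_pos (x := (x + 1) / x) (by positivity)
    have h4 : 1 - ((x + 1) / x)⁻¹ = 1 / (x + 1) := by field_simp; ring
    rw [h4] at h3
    have h5 := Real.add_one_le_exp (Real.log ((x + 1) / x) * δ)
    have h6 : 1 / (x + 1) * δ ≤ Real.log ((x + 1) / x) * δ := by gcongr
    have h7 : δ / (x + 1) = 1 / (x + 1) * δ := by ring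
    linarith
  have h8 : (2 * x) ^ (-1 - δ) ≤ (x + 1) ^ (-1 - δ) :=
    Real.rpow_le_rpow_of_nonpos (by positivity) (by linarith) (by linarith)
  rw [Real.mul_rpow (by norm_num) hx0.le] at h8
  have h9 : (x + 1) ^ (-1 - δ) = (x + 1) ^ (-δ) / (x + 1) := by
    rw [show -1 - δ = -δ - 1 by ring, Real.rpow_sub_one (by positivity)]
  have h10 : (x + 1) ^ (-δ) * (1 + δ / (x + 1)) ≤ x ^ (-δ) := by
    rw [h1]; gcongr
  calc δ * 2 ^ (-1 - δ) * x ^ (-1 - δ) = δ * (2 ^ (-1 - δ) * x ^ (-1 - δ)) := by ring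
    _ ≤ δ * ((x + 1) ^ (-δ) / (x + 1)) := by rw [← h9]; gcongr
    _ = (x + 1) ^ (-δ) * (1 + δ / (x + 1)) - (x + 1) ^ (-δ) := by ring
    _ ≤ _ := by linarith

/-- A null sequence whose decrements are at most `C n ^ (-1 - δ)` is at most
`c C n ^ (-δ)`, where `c` depends on `δ` only. -/
theorem exists_le_rpow_of_sub_le {δ : ℝ} (hδ : 0 < δ) :
    ∃ c : ℝ, 0 < c ∧ ∀ (C : ℝ) (N : ℕ) (a : ℕ → ℝ), 0 ≤ C → 1 ≤ N →
      (∀ n ≥ N, a n - a (n + 1) ≤ C * (n : ℝ) ^ (-1 - δ)) → Tendsto a atTop (nhds 0) →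
      ∀ n ≥ N, a n ≤ c * C * (n : ℝ) ^ (-δ) := by
  set κ : ℝ := δ * 2 ^ (-1 - δ)
  have hκ : 0 < κ := by positivity
  refine ⟨κ⁻¹, inv_pos.mpr hκ, fun C N a hC hN ha hlim n hn => ?_⟩
  -- The corrected sequence `a k - κ⁻¹ * C * k ^ (-δ)` is nondecreasing and tends to 0, so it is
  -- nowhere positive.
  have hb : ∀ k, a n - κ⁻¹ * C * (n : ℝ) ^ (-δ) ≤
      a (n + k) - κ⁻¹ * C * ((n + k : ℕ) : ℝ) ^ (-δ) := by
    intro k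
    induction k with
    | zero => simp
    | succ k ih =>
      refine ih.trans ?_
      have h1 := ha (n + k) (by omega)
      have h2 := rpow_neg_sub_rpow_neg_ge hδ (x := ((n + k : ℕ) : ℝ))
        (by exact_mod_cast (by omega : 1 ≤ n + k))
      have h3 : κ⁻¹ * C * (κ * ((n + k : ℕ) : ℝ) ^ (-1 - δ)) ≤
        κ⁻¹ * C * (((n + k : ℕ) : ℝ) ^ (-δ) - (((n + k : ℕ) : ℝ) + 1) ^ (-δ)) := by gcongr
      have h4 : κ⁻¹ * C * (κ * ((n + k : ℕ) : ℝ) ^ (-1 - δ)) =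
        C * ((n + k : ℕ) : ℝ) ^ (-1 - δ) := by field_simp
      rw [← add_assoc, Nat.cast_succ]
      linarith
  have hz : Tendsto (fun k => a (n + k) - κ⁻¹ * C * ((n + k : ℕ) : ℝ) ^ (-δ)) atTop (nhds 0) := by
    have hsh : Tendsto (fun k => n + k) atTop atTop := 
      tendsto_atTop_mono (fun k => Nat.le_add_left k n) tendsto_id
    have h1 := (tendsto_rpow_neg_atTop hδ).comp (tendsto_natCast_atTop_atTop.comp hsh)
    simpa using (hlim.comp hsh).sub (h1.const_mul (κ⁻¹ * C))
  have := ge_of_tendsto' hz hb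
  linarith

theorem exists_bound_of_isBigO_rpow {f : ℕ → ℝ} {s : ℝ}
    (h : f =O[atTop] fun k : ℕ => (k : ℝ) ^ s) :
    ∃ C : ℝ, 0 ≤ C ∧ ∃ N : ℕ, 1 ≤ N ∧ ∀ n ≥ N, f n ≤ C * (n : ℝ) ^ s := by
  obtain ⟨C, hC, h⟩ := h.exists_nonneg
  obtain ⟨N, hN⟩ := eventually_atTop.mp h.bound
  refine ⟨C, hC, max N 1, le_max_right _ _, fun n hn => ?_⟩
  have h1 := hN n (le_of_max_le_left hn)
  rw [Real.norm_of_nonneg (by positivity : (0 : ℝ) ≤ (n : ℝ) ^ s)] at h1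
  exact (le_abs_self _).trans h1

theorem isBigO_norm_of_bound {E : Type*} [NormedAddCommGroup E] {f : ℕ → E} {g : ℕ → ℝ} {C : ℝ}
    {N : ℕ} (h : ∀ n ≥ N, ‖f n‖ ≤ C * g n) (hg : ∀ n, 0 ≤ g n) :
    (fun n => ‖f n‖) =O[atTop] g := by
  refine IsBigO.of_bound C (eventually_atTop.mpr ⟨N, fun n hn => ?_⟩)
  rw [norm_norm, Real.norm_of_nonneg (hg n)]
  exact h n hn

/-! ### From rates to convergence in operator norm. -/

section ProjectionProducts

variable {H : Type*} [NormedAddCommGroup H] [InnerProductSpace ℝ H] [CompleteSpace H]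
  {l : List (ClosedSubmodule ℝ H)} {N : ClosedSubmodule ℝ H}

/-- Summing the differences of powers. -/
theorem isBigO_pow_mul_of_isBigO_sub (hN : ∀ x, x ∈ N ↔ ∀ K ∈ l, x ∈ K) {B : H →L[ℝ] H}
    (hB : ∀ x, B x ∈ N.toSubmoduleᗮ) {δ : ℝ} (hδ : 0 < δ)
    (h : (fun k : ℕ => ‖(projProd l ^ k - projProd l ^ (k - 1)) * B‖)
      =O[atTop] fun k : ℕ => (k : ℝ) ^ (-1 - δ)) :
    (fun k : ℕ => ‖projProd l ^ k * B‖) =O[atTop] fun k : ℕ => (k : ℝ) ^ (-δ) := by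
  obtain ⟨C, hC, n₀, hn₀, hbd⟩ := exists_bound_of_isBigO_rpow h
  obtain ⟨c, hc, htail⟩ := exists_le_rpow_of_sub_le hδ
  refine isBigO_norm_of_bound (C := c * C) (N := n₀) (fun n hn => ?_) fun n => by positivity
  refine ContinuousLinearMap.opNorm_le_bound _ (by positivity) fun x => ?_
  -- Strong convergence is only pointwise, so the summation is done for each vector; `c` and `n₀` do
  -- not depend on `x`, which makes the result an operator norm bound.
  have := htail (C * ‖x‖) n₀ (fun k => ‖(projProd l ^ k) (B x)‖) (by positivity) hn₀
    (fun k hk => ?_) ?_ n hn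
  · calc _ ≤ _ := this
      _ = _ := by ring
  · have h1 := hbd (k + 1) (by omega)
    have h2 := ((projProd l ^ (k + 1) - projProd l ^ k) * B).le_opNorm x
    have h3 : ((k + 1 : ℕ) : ℝ) ^ (-1 - δ) ≤ (k : ℝ) ^ (-1 - δ) :=
      Real.rpow_le_rpow_of_nonpos (by exact_mod_cast (by omega : 0 < k))
        (by push_cast; linarith) (by linarith)
    have h4 := norm_sub_norm_le ((projProd l ^ k) (B x)) ((projProd l ^ (k + 1)) (B x))
    rw [norm_sub_rev] at h4
    calc _ ≤ _ := h4
      _ ≤ ‖(projProd l ^ (k + 1) - projProd l ^ k) * B‖ * ‖x‖ := h2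
      _ ≤ C * ((k + 1 : ℕ) : ℝ) ^ (-1 - δ) * ‖x‖ := by gcongr; exact h1
      _ ≤ C * (k : ℝ) ^ (-1 - δ) * ‖x‖ := by gcongr
      _ = _ := by ring
  · simpa using (tendsto_projProd_pow_of_mem_orthogonal hN (hB x)).norm

/-- Summing the energies lost in each cycle. -/
theorem isBigO_pow_mul_of_isBigO_coproj (hN : ∀ x, x ∈ N ↔ ∀ K ∈ l, x ∈ K) {B : H →L[ℝ] H}
    (hB : ∀ x, B x ∈ N.toSubmoduleᗮ) {t : ℝ} (ht : 0 < t)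
    (h : ∀ K ∈ l, (fun k : ℕ => ‖coproj K * projProd l ^ k * B‖)
      =O[atTop] fun k : ℕ => (k : ℝ) ^ (-1 / 2 - t)) :
    (fun k : ℕ => ‖projProd l ^ k * B‖) =O[atTop] fun k : ℕ => (k : ℝ) ^ (-t) := by
  have hunif : ∃ C : ℝ, 0 ≤ C ∧ ∃ n₀ : ℕ, 1 ≤ n₀ ∧ ∀ n ≥ n₀, ∀ K ∈ l,
      ‖coproj K * projProd l ^ n * B‖ ≤ C * (n : ℝ) ^ (-1 / 2 - t) := by
    obtain ⟨C, hC, n₀, hn₀, hbd⟩ := exists_bound_of_isBigO_rpow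
      (f := fun k => ∑ i : Fin l.length, ‖coproj (l.get i) * projProd l ^ k * B‖)
      (IsBigO.fun_sum fun i _ => h _ (l.get_mem i))
    refine ⟨C, hC, n₀, hn₀, fun n hn K hK => le_trans ?_ (hbd n hn)⟩
    obtain ⟨i, rfl⟩ := List.mem_iff_get.mp hK
    exact Finset.single_le_sum (f := fun i => ‖coproj (l.get i) * projProd l ^ n * B‖)
      (fun i _ => norm_nonneg _) (Finset.mem_univ i)
  obtain ⟨C, hC, n₀, hn₀, hbd⟩ := hunif
  -- The losses are squares, of order `k ^ (-1 - 2t)`; they sum to `k ^ (-2t)`, and the square root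
  -- gives `k ^ (-t)`.
  obtain ⟨c, hc, htail⟩ := exists_le_rpow_of_sub_le (δ := 2 * t) (by positivity)
  obtain ⟨c', hc', hen⟩ := energy_le_of_norm_coproj_le l
  refine isBigO_norm_of_bound (C := √(c * c') * C) (N := n₀) (fun n hn => ?_)
    fun n => by positivity
  refine ContinuousLinearMap.opNorm_le_bound _ (by positivity) fun x => ?_
  have := htail (c' * (C * ‖x‖) ^ 2) n₀ (fun k => ‖(projProd l ^ k) (B x)‖ ^ 2) (by positivity) hn₀
    (fun k hk => ?_) ?_ n hn
  · have hsq : ((n : ℝ) ^ (-t)) ^ 2 = (n : ℝ) ^ (-(2 * t)) := by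
      rw [← Real.rpow_natCast, ← Real.rpow_mul (by positivity)]
      congr 1; push_cast; ring
    refine abs_le_of_sq_le_sq' ?_ (by positivity) |>.2
    calc ‖(projProd l ^ n * B) x‖ ^ 2 ≤ _ := this
      _ = (c * c') * (C * (n : ℝ) ^ (-t) * ‖x‖) ^ 2 := by rw [← hsq]; ring
      _ = √(c * c') ^ 2 * (C * (n : ℝ) ^ (-t) * ‖x‖) ^ 2 := by rw [Real.sq_sqrt (by positivity)]
      _ = _ := by ring
  · have h1 := hen ((projProd l ^ k) (B x)) (C * (k : ℝ) ^ (-1 / 2 - t) * ‖x‖) fun K hK =>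
      ((coproj K * projProd l ^ k * B).le_opNorm x).trans (by gcongr; exact hbd k hk K hK)
    have hsq : ((k : ℝ) ^ (-1 / 2 - t)) ^ 2 = (k : ℝ) ^ (-1 - 2 * t) := by
      rw [← Real.rpow_natCast, ← Real.rpow_mul (by positivity)]
      congr 1; push_cast; ring
    have h2 : (projProd l ^ (k + 1)) (B x) = projProd l ((projProd l ^ k) (B x)) := by
      rw [pow_succ']; rfl
    rw [h2, ← hsq]
    calc _ ≤ _ := h1
      _ = _ := by ring
  · simpa using ((tendsto_projProd_pow_of_mem_orthogonal hN (hB x)).norm).pow 2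

theorem coproj_mem_orthogonal_of_mem (hN : ∀ x, x ∈ N ↔ ∀ K ∈ l, x ∈ K)
    {K : ClosedSubmodule ℝ H} (hK : K ∈ l) (x : H) : coproj K x ∈ N.toSubmoduleᗮ :=
  Submodule.orthogonal_le (fun _ hy => (hN _).mp hy K hK) (coproj_mem K x)

theorem tendsto_rpow_neg_natCast {t : ℝ} (ht : 0 < t) :
    Tendsto (fun k : ℕ => (k : ℝ) ^ (-t)) atTop (nhds 0) :=
  (tendsto_rpow_neg_atTop ht).comp tendsto_natCast_atTop_atTop

theorem tendsto_pow_of_isBigO_sub (hN : ∀ x, x ∈ N ↔ ∀ K ∈ l, x ∈ K) {ε : ℝ} (hε : 0 < ε)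
    (h : (fun k : ℕ => ‖projProd l ^ k - projProd l ^ (k - 1)‖)
      =O[atTop] fun k : ℕ => (k : ℝ) ^ (-1 - ε)) :
    Tendsto (fun k => projProd l ^ k) atTop (nhds (proj N)) := by
  have h1 : (fun k : ℕ => ‖(projProd l ^ k - projProd l ^ (k - 1)) * coproj N‖)
      =O[atTop] fun k : ℕ => (k : ℝ) ^ (-1 - ε) := by
    refine (IsBigO.of_bound ‖coproj N‖ (Eventually.of_forall fun k => ?_)).trans h
    rw [norm_norm, norm_norm, mul_comm]
    exact norm_mul_le _ _
  have h2 := (isBigO_pow_mul_of_isBigO_sub hN (coproj_mem N) hε h1).trans_tendsto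
    (tendsto_rpow_neg_natCast hε)
  simp only [pow_mul_coproj hN] at h2
  exact tendsto_iff_norm_sub_tendsto_zero.mpr h2

theorem tendsto_pow_of_isBigO_coproj_mul (hN : ∀ x, x ∈ N ↔ ∀ K ∈ l, x ∈ K) {ε : ℝ} (hε : 0 < ε)
    (h : ∀ K ∈ l, (fun k : ℕ => ‖coproj K * projProd l ^ k‖)
      =O[atTop] fun k : ℕ => (k : ℝ) ^ (-1 / 2 - ε)) :
    Tendsto (fun k => projProd l ^ k) atTop (nhds (proj N)) := by
  have h2 := (isBigO_pow_mul_of_isBigO_coproj hN (coproj_mem N) hε fun K hK => by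
    refine (IsBigO.of_bound ‖coproj N‖ (Eventually.of_forall fun k => ?_)).trans (h K hK)
    rw [norm_norm, norm_norm, mul_comm]
    exact norm_mul_le _ _).trans_tendsto (tendsto_rpow_neg_natCast hε)
  simp only [pow_mul_coproj hN] at h2
  exact tendsto_iff_norm_sub_tendsto_zero.mpr h2

/-- Taking adjoints moves the complementary projection to the left and reverses the list. -/
theorem tendsto_pow_of_isBigO_mul_coproj (hN : ∀ x, x ∈ N ↔ ∀ K ∈ l, x ∈ K) {ε : ℝ} (hε : 0 < ε)
    (h : ∀ K ∈ l, (fun k : ℕ => ‖projProd l ^ k * coproj K‖)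
      =O[atTop] fun k : ℕ => (k : ℝ) ^ (-1 / 2 - ε)) :
    Tendsto (fun k => projProd l ^ k) atTop (nhds (proj N)) := by
  have h1 := tendsto_pow_of_isBigO_coproj_mul (l := l.reverse) (N := N) (by simpa using hN) hε
    fun K hK => by
      refine (h K (by simpa using hK)).congr_left fun k => ?_
      rw [← norm_star, star_mul, star_pow, adjoint_projProd,
        (isSelfAdjoint_starProjection K.toSubmoduleᗮ).star_eq]
  have h2 := h1.star
  simpa only [star_pow, adjoint_projProd, List.reverse_reverse,
    (isSelfAdjoint_starProjection N.toSubmodule).star_eq] using h2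

theorem tendsto_pow_of_isBigO_sub_mul_coproj (hN : ∀ x, x ∈ N ↔ ∀ K ∈ l, x ∈ K) {ε : ℝ}
    (hε : 0 < ε) (h : ∀ K ∈ l, (fun k : ℕ => ‖(projProd l ^ k - projProd l ^ (k - 1)) * coproj K‖)
      =O[atTop] fun k : ℕ => (k : ℝ) ^ (-3 / 2 - ε)) :
    Tendsto (fun k => projProd l ^ k) atTop (nhds (proj N)) := by
  refine tendsto_pow_of_isBigO_mul_coproj hN hε fun K hK => ?_
  have := isBigO_pow_mul_of_isBigO_sub hN (coproj_mem_orthogonal_of_mem hN hK) (δ := 1 / 2 + ε)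
    (by positivity) (by convert h K hK using 3; ring)
  convert this using 3
  ring

/-- Summing energies removes the left projection at the price of `1 / 2` in the exponent: with `t =
1 / 2 + ε` the rate `-1 - ε` is `-1 / 2 - t`, and `-t` is what the one-sided condition asks for. -/
theorem tendsto_pow_of_isBigO_coproj_mul_coproj (hN : ∀ x, x ∈ N ↔ ∀ K ∈ l, x ∈ K) {ε : ℝ}
    (hε : 0 < ε) (h : ∀ K ∈ l, ∀ J ∈ l, (fun k : ℕ => ‖coproj K * projProd l ^ k * coproj J‖)
      =O[atTop] fun k : ℕ => (k : ℝ) ^ (-1 - ε)) :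
    Tendsto (fun k => projProd l ^ k) atTop (nhds (proj N)) := by
  refine tendsto_pow_of_isBigO_mul_coproj hN hε fun J hJ => ?_
  have := isBigO_pow_mul_of_isBigO_coproj hN (coproj_mem_orthogonal_of_mem hN hJ) (t := 1 / 2 + ε)
    (by positivity) fun K hK => by convert h K hK J hJ using 3; ring
  convert this using 3
  ring

/-! ### Closedness of the sum and strict contraction. -/

theorem isClosed_of_norm_pow_sub_lt_one (hN : ∀ x, x ∈ N ↔ ∀ K ∈ l, x ∈ K) {S : Submodule ℝ H}
    (hS : ∀ K ∈ l, K.toSubmoduleᗮ ≤ S) (hSN : S ≤ N.toSubmoduleᗮ) {n : ℕ}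
    (hn : ‖projProd l ^ n - proj N‖ < 1) : IsClosed (S : Set H) := by
  suffices h : N.toSubmoduleᗮ ≤ S by
    rw [le_antisymm hSN h]
    exact N.toSubmodule.isClosed_orthogonal
  intro y hy
  -- Solve `y = x - (T ^ n - P_N) x`. Applying `P_N` gives `P_N x = 0`, so `y = x - T ^ n x`.
  obtain ⟨u, hu⟩ := isUnit_one_sub_of_norm_lt_one hn
  set x := (↑u⁻¹ : H →L[ℝ] H) y
  have hx : y = x - ((projProd l ^ n) x - proj N x) := by
    have h1 : (u : H →L[ℝ] H) x = y := by
      change ((u : H →L[ℝ] H) * ↑u⁻¹) y = y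
      rw [u.mul_inv]; rfl
    rw [← h1, hu]; rfl
  have hPn : proj N * projProd l ^ n = proj N := by
    clear hn hu hx
    induction n with
    | zero => simp
    | succ n ih => rw [pow_succ, ← mul_assoc, ih, proj_mul_projProd hN]
  have h2 : proj N y = 0 := N.toSubmodule.starProjection_apply_eq_zero_iff.mpr hy
  have h3 : proj N ((projProd l ^ n) x) = proj N x := congrArg (· x) hPn
  have h4 : proj N (proj N x) = proj N x := proj_of_mem (N.toSubmodule.starProjection_apply_mem x)
  have h5 : proj N x = 0 := by
    have := congrArg (proj N) hx
    rw [h2, map_sub, map_sub, h3, h4] at this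
    simpa using this.symm
  rw [hx, h5, sub_zero]
  exact sub_projProd_pow_mem hS n x

theorem norm_projProd_sub_lt_one (hN : ∀ x, x ∈ N ↔ ∀ K ∈ l, x ∈ K) {C : ℝ}
    (hC : ∀ x ∈ N.toSubmoduleᗮ, ∀ δ : ℝ, (∀ K ∈ l, ‖coproj K x‖ ≤ δ) → ‖x‖ ≤ C * δ) :
    ‖projProd l - proj N‖ < 1 := by
  obtain ⟨c, hc, hen⟩ := norm_coproj_sq_le_energy l
  -- Regularity with `δ = √(c * e)` gives `‖x‖² ≤ D * e`: a cycle loses at least the fraction `D⁻¹`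
  -- of the energy. The summand 1 keeps `D⁻¹` in `(0, 1]`.
  set D : ℝ := C ^ 2 * c + 1
  have hD : 1 ≤ D := by have : 0 ≤ C ^ 2 * c := by positivity
                        simp only [D]; linarith
  have hbound : ∀ x ∈ N.toSubmoduleᗮ, ‖projProd l x‖ ^ 2 ≤ (1 - D⁻¹) * ‖x‖ ^ 2 := by
    intro x hx
    set e := ‖x‖ ^ 2 - ‖projProd l x‖ ^ 2 with he
    have he0 : 0 ≤ e := by
      have h := norm_projProd_apply_le l x
      have : ‖projProd l x‖ ^ 2 ≤ ‖x‖ ^ 2 := by gcongr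
      linarith
    have h1 := hC x hx √(c * e) fun K hK => Real.le_sqrt_of_sq_le (hen K hK x)
    have h2 : ‖x‖ ^ 2 ≤ C ^ 2 * (c * e) := by
      calc ‖x‖ ^ 2 ≤ (C * √(c * e)) ^ 2 := by gcongr
        _ = _ := by rw [mul_pow, Real.sq_sqrt (by positivity)]
    have h3 : ‖x‖ ^ 2 ≤ D * e := by simp only [D]; linarith
    have h4 : D⁻¹ * ‖x‖ ^ 2 ≤ e := by
      rw [inv_mul_le_iff₀ (by positivity)]; exact h3
    linarith
  have hD1 : 0 ≤ 1 - D⁻¹ := by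
    have := inv_le_one_of_one_le₀ hD
    linarith
  have hlt : √(1 - D⁻¹) < 1 := by
    rw [Real.sqrt_lt' one_pos]
    have : 0 < D⁻¹ := by positivity
    linarith
  refine lt_of_le_of_lt (ContinuousLinearMap.opNorm_le_bound _ (by positivity) fun x => ?_) hlt
  have h1 := hbound (coproj N x) (coproj_mem N x)
  have h2 : (projProd l - proj N) x = projProd l (coproj N x) := by
    have := congrArg (· x) (pow_mul_coproj hN 1)
    simpa using this.symm
  rw [h2]
  refine abs_le_of_sq_le_sq' ?_ (by positivity) |>.2
  rw [mul_pow, Real.sq_sqrt hD1]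
  refine h1.trans ?_
  gcongr
  exact norm_coproj_apply_le N x

end ProjectionProducts

/-- Closedness of the sum of the orthogonal complements gives linear regularity. -/
theorem exists_norm_le_of_isClosed_iSup {H : Type*} [NormedAddCommGroup H] [InnerProductSpace ℝ H]
    [CompleteSpace H] {m : ℕ} (M : Fin m → ClosedSubmodule ℝ H)
    (hS : IsClosed ((⨆ i, (M i).toSubmoduleᗮ : Submodule ℝ H) : Set H)) :
    ∃ C : ℝ, ∀ x ∈ (⨆ i, (M i).toSubmoduleᗮ : Submodule ℝ H), ∀ δ : ℝ,
      (∀ i, ‖coproj (M i) x‖ ≤ δ) → ‖x‖ ≤ C * δ := by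
  set S : Submodule ℝ H := ⨆ i, (M i).toSubmoduleᗮ
  let f : (Π i, (M i).toSubmoduleᗮ) →L[ℝ] H :=
    ∑ i, (M i).toSubmoduleᗮ.subtypeL.comp (ContinuousLinearMap.proj i)
  have hf : ∀ y, f y = ∑ i, (y i : H) := fun y => by simp [f]
  have hfS : ∀ y, f y ∈ S := fun y => by
    rw [hf]
    exact S.sum_mem fun i _ => le_iSup (fun i => (M i).toSubmoduleᗮ) i (y i).2
  let g := f.codRestrict S hfS
  have : CompleteSpace S := hS.completeSpace_coe
  have hg : Function.Surjective g := by
    rintro ⟨x, hx⟩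
    obtain ⟨y, hy⟩ := (Submodule.mem_iSup_iff_exists_finsupp _ x).mp hx
    refine ⟨fun i => ⟨y i, hy.1 i⟩, Subtype.ext ?_⟩
    change f _ = x
    rw [hf]
    exact (Finsupp.sum_fintype _ _ fun _ => rfl).symm.trans hy.2
  -- Open mapping theorem for addition onto `S`: each `x ∈ S` splits into pieces of size at most `C
  -- * ‖x‖`. Pairing `x` with its own pieces then only sees `coproj (M i) x`.
  obtain ⟨C, hC, h⟩ := g.exists_preimage_norm_le hg
  refine ⟨m * C, fun x hx δ hδ => ?_⟩
  obtain ⟨y, hy, hyC⟩ := h ⟨x, hx⟩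
  have hy' : x = ∑ i, (y i : H) := by rw [← hf]; exact (congrArg Subtype.val hy).symm
  have h1 : ‖x‖ * ‖x‖ ≤ (m * C * δ) * ‖x‖ := by
    calc ‖x‖ * ‖x‖ = ∑ i, inner ℝ x (y i : H) := by
          rw [← real_inner_self_eq_norm_mul_norm, ← inner_sum, ← hy']
      _ ≤ ∑ _i : Fin m, δ * (C * ‖x‖) := Finset.sum_le_sum fun i _ => ?_
      _ = _ := by simp; ring
    have h2 : inner ℝ x (y i : H) = inner ℝ (coproj (M i) x) (y i : H) := by
      rw [coproj, Submodule.inner_starProjection_left_eq_right,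
        Submodule.starProjection_eq_self_iff.mpr (y i).2]
    rw [h2]
    refine (real_inner_le_norm _ _).trans ?_
    have h3 : ‖(y i : H)‖ ≤ C * ‖x‖ := (norm_le_pi_norm y i).trans hyC
    have h4 := hδ i
    have h5 := (norm_nonneg _).trans h4
    gcongr
  rcases (norm_nonneg x).eq_or_lt with h0 | h0
  · rw [← h0]
    -- For `m = 0` nothing makes `δ` nonnegative, but the factor `m` annihilates the right side.
    rcases Nat.eq_zero_or_pos m with rfl | hm
    · simp
    · have := (norm_nonneg _).trans (hδ ⟨0, hm⟩)
      positivity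
  · exact le_of_mul_le_mul_right h1 h0

theorem isBigO_iSup_norm_iff {ι E : Type*} [Fintype ι] [Nonempty ι] [NormedAddCommGroup E]
    {f : ℕ → ι → E} {g : ℕ → ℝ} :
    (fun k => ⨆ i, ‖f k i‖) =O[atTop] g ↔ ∀ i, (fun k => ‖f k i‖) =O[atTop] g := by
  have hle : ∀ k i, ‖f k i‖ ≤ ⨆ i, ‖f k i‖ := fun k i =>
    le_ciSup (f := fun i => ‖f k i‖) (Set.finite_range _).bddAbove i
  constructor
  · intro h i
    refine (IsBigO.of_norm_le fun k => ?_).trans h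
    rw [norm_norm]
    exact hle k i
  · intro h
    refine (IsBigO.of_norm_le fun k => ?_).trans
      (IsBigO.fun_sum (A := fun i k => ‖f k i‖) (s := Finset.univ) fun i _ => h i)
    rw [Real.norm_of_nonneg (Real.iSup_nonneg fun i => norm_nonneg _)]
    exact ciSup_le fun i =>
      Finset.single_le_sum (f := fun i => ‖f k i‖) (fun i _ => norm_nonneg _) (Finset.mem_univ i)

theorem isBigO_comp_comp {E F G K : Type*} [NormedAddCommGroup E] [NormedSpace ℝ E]
    [NormedAddCommGroup F] [NormedSpace ℝ F] [NormedAddCommGroup G] [NormedSpace ℝ G]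
    [NormedAddCommGroup K] [NormedSpace ℝ K] {g : ℕ → ℝ} {X : ℕ → F →L[ℝ] G}
    (h : X =O[atTop] g) (A : G →L[ℝ] K) (B : E →L[ℝ] F) :
    (fun k => A ∘L X k ∘L B) =O[atTop] g := by
  refine (IsBigO.of_bound (‖A‖ * ‖B‖) (Eventually.of_forall fun k => ?_)).trans h
  calc _ ≤ ‖A‖ * (‖X k‖ * ‖B‖) := (A.opNorm_comp_le _).trans (by
        gcongr; exact (X k).opNorm_comp_le B)
    _ = _ := by ring

theorem cyclicProjection_toSubmodule {H : Type*} [NormedAddCommGroup H] [InnerProductSpace ℝ H]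
    [CompleteSpace H] {m : ℕ} (M : Fin m → ClosedSubmodule ℝ H) :
    cyclicProjection (fun i => (M i).toSubmodule) = projProd (List.ofFn M) := by
  rw [cyclicProjection, projProd, List.map_ofFn]
  rfl

/-! ### Maps between `H` and the product space. -/

namespace ProductSpace

variable {H : Type*} [NormedAddCommGroup H] [InnerProductSpace ℝ H] {m : ℕ}

theorem norm_sq_eq (x : ProductSpace H m) : ‖x‖ ^ 2 = (1 / (m : ℝ)) * ∑ i, ‖x i‖ ^ 2 := by
  rw [norm_def, Real.sq_sqrt (by positivity)]

/-- The coordinate map. -/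
noncomputable def evalL (i : Fin m) : ProductSpace H m →L[ℝ] H :=
  LinearMap.mkContinuous ⟨⟨fun x => x i, fun _ _ => rfl⟩, fun _ _ => rfl⟩ √m fun x => by
    -- One coordinate is bounded by the whole sum, which is `m` times the squared norm.
    refine abs_le_of_sq_le_sq' ?_ (by positivity) |>.2
    have hm : (m : ℝ) ≠ 0 := by have := i.pos; positivity
    rw [mul_pow, Real.sq_sqrt (by positivity), norm_sq_eq, ← mul_assoc, mul_one_div_cancel hm,
      one_mul]
    exact Finset.single_le_sum (f := fun i => ‖x i‖ ^ 2) (fun i _ => by positivity)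
      (Finset.mem_univ i)

theorem evalL_apply (i : Fin m) (x : ProductSpace H m) : evalL i x = x i := rfl

/-- The diagonal map. -/
noncomputable def diagL : H →L[ℝ] ProductSpace H m :=
  LinearMap.mkContinuous ⟨⟨fun h => ⟨fun _ => h⟩, fun _ _ => rfl⟩, fun _ _ => rfl⟩ 1 fun h => by
    refine abs_le_of_sq_le_sq' ?_ (by positivity) |>.2
    rw [norm_sq_eq]
    rcases Nat.eq_zero_or_pos m with rfl | hm
    · simp
    · have hm' : (m : ℝ) ≠ 0 := by positivity
      change 1 / (m : ℝ) * ∑ _i : Fin m, ‖h‖ ^ 2 ≤ _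
      simp [hm']

theorem diagL_apply (h : H) (i : Fin m) : (diagL h : ProductSpace H m) i = h := rfl

/-- The embedding of a factor. -/
noncomputable def singleL (i : Fin m) : H →L[ℝ] ProductSpace H m :=
  LinearMap.mkContinuous ⟨⟨fun h => ⟨Pi.single i h⟩, fun a b => by
      ext j; exact congrFun (Pi.single_add (f := fun _ : Fin m => H) i a b) j⟩, fun r a => by
      ext j; exact congrFun (Pi.single_smul (f := fun _ : Fin m => H) i r a) j⟩ 1 fun h => by
    refine abs_le_of_sq_le_sq' ?_ (by positivity) |>.2
    rw [norm_sq_eq]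
    have h1 : ∑ j, ‖(Pi.single i h : Fin m → H) j‖ ^ 2 = ‖h‖ ^ 2 := by
      rw [Finset.sum_eq_single i (fun j _ hj => by simp [hj]) (by simp)]
      simp
    have h2 : 1 / (m : ℝ) ≤ 1 := by
      rw [one_div]
      exact inv_le_one_of_one_le₀ (by exact_mod_cast i.pos)
    change 1 / (m : ℝ) * ∑ j, ‖(Pi.single i h : Fin m → H) j‖ ^ 2 ≤ _
    rw [h1, one_mul]
    exact mul_le_of_le_one_left (by positivity) h2

theorem singleL_apply (i j : Fin m) (h : H) :
    (singleL i h : ProductSpace H m) j = (Pi.single i h : Fin m → H) j := rfl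

theorem coord_sum {ι : Type*} (s : Finset ι) (f : ι → ProductSpace H m) (i : Fin m) :
    (∑ j ∈ s, f j) i = ∑ j ∈ s, f j i :=
  map_sum (evalL i) f s

/-- The average of the coordinates. -/
noncomputable def meanL : ProductSpace H m →L[ℝ] H := (1 / (m : ℝ)) • ∑ i, evalL i

theorem meanL_apply (x : ProductSpace H m) : meanL x = (1 / (m : ℝ)) • ∑ i, x i := by
  simp [meanL, evalL_apply]

theorem starProjection_diagonal_apply (x : ProductSpace H m) :
    (diagonal H m).starProjection x = diagL (meanL x) := by
  refine Submodule.eq_starProjection_of_mem_of_inner_eq_zero ⟨_, rfl⟩ ?_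
  rintro _ ⟨a, rfl⟩
  rw [inner_def, meanL_apply]
  rcases Nat.eq_zero_or_pos m with rfl | hm
  · simp
  · have hm' : (m : ℝ) ≠ 0 := by positivity
    simp only [sub_apply, inner_sub_left, Finset.sum_sub_distrib, diagL_apply,
      real_inner_smul_left, sum_inner, Finset.sum_const, Finset.card_univ, Fintype.card_fin,
      nsmul_eq_mul]
    field_simp
    simp

theorem meanL_diagL (hm : 0 < m) (h : H) : meanL (diagL h : ProductSpace H m) = h := by
  have hm' : (m : ℝ) ≠ 0 := by positivity
  simp [meanL_apply, diagL_apply, ← Nat.cast_smul_eq_nsmul ℝ, smul_smul, hm']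

theorem meanL_singleL (i : Fin m) (h : H) :
    meanL (singleL i h : ProductSpace H m) = (1 / (m : ℝ)) • h := by
  rw [meanL_apply]
  congr 1
  simp only [singleL_apply]
  exact Fintype.sum_pi_single' i h

theorem eq_sum_singleL (x : ProductSpace H m) : x = ∑ i, singleL i (x i) := by
  ext j
  rw [coord_sum]
  simp only [singleL_apply]
  exact (Fintype.sum_pi_single j fun i => x i).symm

theorem starProjection_pi_apply (K : Fin m → Submodule ℝ H) [∀ i, (K i).HasOrthogonalProjection]
    (x : ProductSpace H m) (i : Fin m) :
    (pi K).starProjection x i = (K i).starProjection (x i) := by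
  have : (⟨fun i => (K i).starProjection (x i)⟩ : ProductSpace H m) = (pi K).starProjection x := by
    have hmem : (⟨fun i => (K i).starProjection (x i)⟩ : ProductSpace H m) ∈ pi K :=
      fun i => (K i).starProjection_apply_mem _
    refine (Submodule.eq_starProjection_of_mem_of_inner_eq_zero hmem fun u hu => ?_).symm
    rw [inner_def, Finset.sum_eq_zero, mul_zero]
    intro i _
    exact (K i).starProjection_inner_eq_zero (x i) (u i) (hu i)
  rw [← this]

theorem starProjection_pi_orthogonal_apply (K : Fin m → Submodule ℝ H)
    [∀ i, (K i).HasOrthogonalProjection] (x : ProductSpace H m) (i : Fin m) :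
    (pi K)ᗮ.starProjection x i = (K i)ᗮ.starProjection (x i) := by
  rw [Submodule.starProjection_orthogonal_val, Submodule.starProjection_orthogonal_val, sub_apply,
    starProjection_pi_apply]

theorem starProjection_pi_orthogonal_singleL (K : Fin m → Submodule ℝ H)
    [∀ i, (K i).HasOrthogonalProjection] (i : Fin m) (h : H) :
    (pi K)ᗮ.starProjection (singleL i h) = singleL i ((K i)ᗮ.starProjection h) := by
  ext j
  rw [starProjection_pi_orthogonal_apply, singleL_apply, singleL_apply]
  rcases eq_or_ne j i with rfl | hj
  · rw [Pi.single_eq_same, Pi.single_eq_same]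
  · rw [Pi.single_eq_of_ne hj, Pi.single_eq_of_ne hj, map_zero]

theorem starProjection_pi_orthogonal_eq_sum (K : Fin m → Submodule ℝ H)
    [∀ i, (K i).HasOrthogonalProjection] (x : ProductSpace H m) :
    (pi K)ᗮ.starProjection x = ∑ i, singleL i ((K i)ᗮ.starProjection (x i)) := by
  rw [eq_sum_singleL ((pi K)ᗮ.starProjection x)]
  simp only [starProjection_pi_orthogonal_apply]

theorem meanL_starProjection_pi_orthogonal (K : Fin m → Submodule ℝ H)
    [∀ i, (K i).HasOrthogonalProjection] (x : ProductSpace H m) :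
    meanL ((pi K)ᗮ.starProjection x) = (1 / (m : ℝ)) • ∑ i, (K i)ᗮ.starProjection (x i) := by
  rw [meanL_apply]
  simp only [starProjection_pi_orthogonal_apply]

/-- Each factor acts on all coordinates by the same projection, so the diagonal is preserved and the
product acts on it as its counterpart on `H`. -/
theorem cyclicProjection_pi_diagL (K : Fin m → Submodule ℝ H)
    [∀ i, (K i).HasOrthogonalProjection] (h : H) :
    cyclicProjection (fun i => pi fun _ : Fin m => K i) (diagL h) =
      diagL (cyclicProjection K h) := by
  have : ∀ L : List (Fin m),
      (L.map fun i => (pi fun _ : Fin m => K i).starProjection).prod (diagL h) =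
        diagL ((L.map fun i => (K i).starProjection).prod h) := by
    intro L
    induction L with
    | nil => rfl
    | cons a L ih =>
      rw [List.map_cons, List.prod_cons, List.map_cons, List.prod_cons]
      refine (congrArg (pi fun _ : Fin m => K a).starProjection ih).trans ?_
      ext j
      exact starProjection_pi_apply (fun _ : Fin m => K a) _ j
  simp only [cyclicProjection, List.ofFn_eq_map, ← List.map_reverse]
  exact this _

theorem pow_diagL {TT : ProductSpace H m →L[ℝ] ProductSpace H m} {T : H →L[ℝ] H}
    (h : ∀ x, TT (diagL x) = diagL (T x)) (k : ℕ) (x : H) :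
    (TT ^ k) (diagL x) = diagL ((T ^ k) x) := by
  induction k with
  | zero => rfl
  | succ k ih =>
    rw [pow_succ', pow_succ']
    change TT ((TT ^ k) (diagL x)) = diagL (T ((T ^ k) x))
    rw [ih, h]

/-! ### Equivalence of the rates on `H` and on the product space. -/

section Transfer

variable {FF : ℕ → ProductSpace H m →L[ℝ] ProductSpace H m}
  {F : ℕ → H →L[ℝ] H} {g : ℕ → ℝ}

/-- Each side is the other one composed with fixed bounded maps, since `P_D` is `diagL` after
`meanL`. The pair `FF`, `F` is arbitrary so as to cover both powers and differences of powers. -/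
theorem isBigO_mul_diagonal_iff (hm : 0 < m) (hF : ∀ k x, FF k (diagL x) = diagL (F k x)) :
    (fun k => ‖FF k * (diagonal H m).starProjection‖) =O[atTop] g ↔
      (fun k => ‖F k‖) =O[atTop] g := by
  have hPD : ∀ k x, (FF k * (diagonal H m).starProjection) x = diagL (F k (meanL x)) :=
    fun k x => (congrArg (FF k) (starProjection_diagonal_apply x)).trans (hF k _)
  constructor <;> intro h
  · refine IsBigO.norm_left ((isBigO_comp_comp h.of_norm_left (evalL ⟨0, hm⟩) diagL).congr_left fun k => ?_)
    ext x
    change ((FF k * (diagonal H m).starProjection) (diagL x)) ⟨0, hm⟩ = F k x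
    rw [hPD, meanL_diagL hm, diagL_apply]
  · refine IsBigO.norm_left ((isBigO_comp_comp h.of_norm_left diagL meanL).congr_left fun k => ?_)
    ext1 x
    exact (hPD k x).symm

variable [CompleteSpace H] (M : Fin m → ClosedSubmodule ℝ H)

theorem isBigO_orthogonal_mul_diagonal_iff (hm : 0 < m)
    (hF : ∀ k x, FF k (diagL x) = diagL (F k x)) :
    (fun k => ‖(pi fun i => (M i).toSubmodule)ᗮ.starProjection * FF k *
        (diagonal H m).starProjection‖) =O[atTop] g ↔
      ∀ i, (fun k => ‖coproj (M i) * F k‖) =O[atTop] g := by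
  set PC : ProductSpace H m →L[ℝ] ProductSpace H m :=
    (pi fun i => (M i).toSubmodule)ᗮ.starProjection with hPC
  have hPD : ∀ k x, (PC * FF k * (diagonal H m).starProjection) x = PC (diagL (F k (meanL x))) :=
    fun k x => congrArg PC
      ((congrArg (FF k) (starProjection_diagonal_apply x)).trans (hF k _))
  constructor
  · intro h i
    refine IsBigO.norm_left ((isBigO_comp_comp h.of_norm_left (evalL i) diagL).congr_left fun k => ?_)
    ext x
    change ((PC * FF k * (diagonal H m).starProjection) (diagL x)) i = coproj (M i) (F k x)
    rw [hPD, meanL_diagL hm, hPC, starProjection_pi_orthogonal_apply, diagL_apply]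
  · intro h
    refine IsBigO.norm_left ((IsBigO.fun_sum (s := Finset.univ) fun i _ => isBigO_comp_comp (h i).of_norm_left
      (singleL i) meanL).congr_left fun k => ?_)
    ext1 x
    rw [hPD, hPC, starProjection_pi_orthogonal_eq_sum, _root_.sum_apply]
    rfl

theorem isBigO_mul_diagonal_mul_orthogonal_iff (hm : 0 < m)
    (hF : ∀ k x, FF k (diagL x) = diagL (F k x)) :
    (fun k => ‖FF k * (diagonal H m).starProjection *
        (pi fun i => (M i).toSubmodule)ᗮ.starProjection‖) =O[atTop] g ↔
      ∀ i, (fun k => ‖F k * coproj (M i)‖) =O[atTop] g := by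
  have hm' : (m : ℝ) ≠ 0 := by positivity
  set PC : ProductSpace H m →L[ℝ] ProductSpace H m :=
    (pi fun i => (M i).toSubmodule)ᗮ.starProjection with hPC
  have hPD : ∀ k x, (FF k * (diagonal H m).starProjection * PC) x = diagL (F k (meanL (PC x))) :=
    fun k x => (congrArg (FF k) (starProjection_diagonal_apply (PC x))).trans (hF k _)
  constructor
  · intro h i
    -- Averaging a vector supported in one coordinate divides it by `m`; the scalar `m` undoes this.
    refine IsBigO.norm_left ((isBigO_comp_comp h.of_norm_left ((m : ℝ) • evalL ⟨0, hm⟩) (singleL i)).congr_left fun k => ?_)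
    ext x
    change (m : ℝ) • ((FF k * (diagonal H m).starProjection * PC) (singleL i x)) ⟨0, hm⟩ =
      F k (coproj (M i) x)
    rw [hPD, hPC, starProjection_pi_orthogonal_singleL, meanL_singleL, diagL_apply, map_smul,
      smul_smul, mul_one_div_cancel hm', one_smul]
  · intro h
    refine IsBigO.norm_left ((IsBigO.fun_sum (s := Finset.univ) fun i _ => isBigO_comp_comp (h i).of_norm_left
      ((1 / (m : ℝ)) • diagL) (evalL i)).congr_left fun k => ?_)
    ext1 x
    rw [hPD, hPC, meanL_starProjection_pi_orthogonal, _root_.sum_apply, map_smul,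
      map_smul, map_sum, map_sum, Finset.smul_sum]
    rfl

theorem isBigO_orthogonal_mul_diagonal_mul_orthogonal_iff (hm : 0 < m)
    (hF : ∀ k x, FF k (diagL x) = diagL (F k x)) :
    (fun k => ‖(pi fun i => (M i).toSubmodule)ᗮ.starProjection * FF k *
        (diagonal H m).starProjection * (pi fun i => (M i).toSubmodule)ᗮ.starProjection‖)
          =O[atTop] g ↔
      ∀ p : Fin m × Fin m, (fun k => ‖coproj (M p.1) * F k * coproj (M p.2)‖) =O[atTop] g := by
  have hm' : (m : ℝ) ≠ 0 := by positivity
  set PC : ProductSpace H m →L[ℝ] ProductSpace H m :=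
    (pi fun i => (M i).toSubmodule)ᗮ.starProjection with hPC
  have hPD : ∀ k x, (PC * FF k * (diagonal H m).starProjection * PC) x =
      PC (diagL (F k (meanL (PC x)))) := fun k x => congrArg PC
    ((congrArg (FF k) (starProjection_diagonal_apply (PC x))).trans (hF k _))
  constructor
  · intro h p
    refine IsBigO.norm_left ((isBigO_comp_comp h.of_norm_left ((m : ℝ) • evalL p.1) (singleL p.2)).congr_left fun k => ?_)
    ext x
    change (m : ℝ) • ((PC * FF k * (diagonal H m).starProjection * PC) (singleL p.2 x)) p.1 =
      coproj (M p.1) (F k (coproj (M p.2) x))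
    rw [hPD, hPC, starProjection_pi_orthogonal_singleL, starProjection_pi_orthogonal_apply,
      meanL_singleL, diagL_apply, map_smul, map_smul,
      smul_smul, mul_one_div_cancel hm', one_smul]
  · intro h
    refine IsBigO.norm_left ((IsBigO.fun_sum (s := Finset.univ) fun i _ => IsBigO.fun_sum (s := Finset.univ)
      fun j _ => isBigO_comp_comp (h (i, j)).of_norm_left ((1 / (m : ℝ)) • singleL i)
      (evalL j)).congr_left fun k => ?_)
    ext1 x
    rw [hPD, hPC, starProjection_pi_orthogonal_eq_sum, _root_.sum_apply]
    refine Finset.sum_congr rfl fun i _ => ?_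
    rw [diagL_apply, meanL_starProjection_pi_orthogonal, _root_.sum_apply, map_smul,
      map_smul, map_smul, map_sum, map_sum, map_sum, Finset.smul_sum]
    rfl

end Transfer

end ProductSpace

/-! ### Geometric rates from a strict contraction. -/

section Geometric

variable {H : Type*} [NormedAddCommGroup H] [InnerProductSpace ℝ H] [CompleteSpace H]
  {l : List (ClosedSubmodule ℝ H)} {N : ClosedSubmodule ℝ H} {q : ℝ}

theorem norm_pow_sub_proj_le (hN : ∀ x, x ∈ N ↔ ∀ K ∈ l, x ∈ K)
    (hq : ‖projProd l - proj N‖ ≤ q) (k : ℕ) : ‖projProd l ^ k - proj N‖ ≤ q ^ k := by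
  rw [← pow_mul_coproj hN]
  exact (norm_pow_mul_coproj_le hN k).trans (by gcongr)

theorem isBigO_pow_sub_proj (hN : ∀ x, x ∈ N ↔ ∀ K ∈ l, x ∈ K)
    (hq : ‖projProd l - proj N‖ ≤ q) :
    (fun k => projProd l ^ k - proj N) =O[atTop] fun k => q ^ k :=
  IsBigO.of_norm_le fun k => (norm_pow_sub_proj_le hN hq k)

theorem isBigO_pow_sub_pow (hN : ∀ x, x ∈ N ↔ ∀ K ∈ l, x ∈ K) (hq0 : 0 < q)
    (hq : ‖projProd l - proj N‖ ≤ q) :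
    (fun k => projProd l ^ k - projProd l ^ (k - 1)) =O[atTop] fun k => q ^ k := by
  have h : (fun k => projProd l ^ (k - 1) - proj N) =O[atTop] fun k => q ^ k := by
    -- For `k ≥ 1`, `q ^ (k - 1) = q⁻¹ * q ^ k`; this is where `q` must be nonzero.
    refine IsBigO.of_bound q⁻¹ (eventually_atTop.mpr ⟨1, fun k hk => ?_⟩)
    refine (norm_pow_sub_proj_le hN hq (k - 1)).trans (le_of_eq ?_)
    obtain ⟨j, rfl⟩ := Nat.exists_eq_add_of_le' hk
    rw [Real.norm_of_nonneg (by positivity), pow_succ]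
    simp only [Nat.add_sub_cancel]
    field_simp
  exact ((isBigO_pow_sub_proj hN hq).sub h).congr_left fun k => sub_sub_sub_cancel_right _ _ _

theorem coproj_mul_proj_of_mem (hN : ∀ x, x ∈ N ↔ ∀ K ∈ l, x ∈ K) {K : ClosedSubmodule ℝ H}
    (hK : K ∈ l) : coproj K * proj N = 0 := by
  ext x
  exact (coproj_eq_zero_iff K _).mpr
    ((hN _).mp (N.toSubmodule.starProjection_apply_mem x) K hK)

theorem proj_mul_coproj_of_mem (hN : ∀ x, x ∈ N ↔ ∀ K ∈ l, x ∈ K) {K : ClosedSubmodule ℝ H}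
    (hK : K ∈ l) : proj N * coproj K = 0 := by
  ext x
  exact N.toSubmodule.starProjection_apply_eq_zero_iff.mpr (coproj_mem_orthogonal_of_mem hN hK x)

theorem isBigO_coproj_mul_pow (hN : ∀ x, x ∈ N ↔ ∀ K ∈ l, x ∈ K)
    (hq : ‖projProd l - proj N‖ ≤ q) {K : ClosedSubmodule ℝ H} (hK : K ∈ l) :
    (fun k => coproj K * projProd l ^ k) =O[atTop] fun k => q ^ k :=
  (isBigO_comp_comp (isBigO_pow_sub_proj hN hq) (coproj K) 1).congr_left fun k => by
    change coproj K * ((projProd l ^ k - proj N) * 1) = _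
    rw [mul_one, mul_sub, coproj_mul_proj_of_mem hN hK, sub_zero]

theorem isBigO_pow_mul_coproj (hN : ∀ x, x ∈ N ↔ ∀ K ∈ l, x ∈ K)
    (hq : ‖projProd l - proj N‖ ≤ q) {K : ClosedSubmodule ℝ H} (hK : K ∈ l) :
    (fun k => projProd l ^ k * coproj K) =O[atTop] fun k => q ^ k :=
  (isBigO_comp_comp (isBigO_pow_sub_proj hN hq) 1 (coproj K)).congr_left fun k => by
    change 1 * ((projProd l ^ k - proj N) * coproj K) = _
    rw [one_mul, sub_mul, proj_mul_coproj_of_mem hN hK, sub_zero]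

end Geometric

/-! ### Assembly of the theorem. -/

theorem lemma4p2 {H : Type*} [NormedAddCommGroup H] [InnerProductSpace ℝ H] [CompleteSpace H]
    (m : ℕ) (hm : 1 ≤ m) (M : Fin m → ClosedSubmodule ℝ H) :
    let P : Fin m → (H →L[ℝ] H) := fun i => (M i).toSubmoduleᗮ.starProjection
    let T : H →L[ℝ] H := cyclicProjection fun i => (M i).toSubmodule
    let PM : H →L[ℝ] H := (⨅ i, M i).toSubmodule.starProjection
    let TT : ProductSpace H m →L[ℝ] ProductSpace H m :=
      cyclicProjection fun i => ProductSpace.pi fun _ : Fin m => (M i).toSubmodule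
    let PD : ProductSpace H m →L[ℝ] ProductSpace H m := (ProductSpace.diagonal H m).starProjection
    let PC : ProductSpace H m →L[ℝ] ProductSpace H m :=
      (ProductSpace.pi fun i => (M i).toSubmodule)ᗮ.starProjection
    let S : Submodule ℝ H := ⨆ i, (M i).toSubmoduleᗮ
    (IsClosed (S : Set H) ↔ ‖T - PM‖ < 1) ∧
    ∀ ε : ℝ, 0 < ε →
      ((fun k : ℕ => ‖T ^ k - T ^ (k - 1)‖) =O[atTop] (fun k : ℕ => (k : ℝ) ^ (-1 - ε)) ∨
       (fun k : ℕ => ⨆ i, ‖P i * T ^ k‖) =O[atTop] (fun k : ℕ => (k : ℝ) ^ (-1 / 2 - ε)) ∨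
       (fun k : ℕ => ⨆ i, ‖T ^ k * P i‖) =O[atTop] (fun k : ℕ => (k : ℝ) ^ (-1 / 2 - ε)) ∨
       (fun k : ℕ => ⨆ i, ‖(T ^ k - T ^ (k - 1)) * P i‖)
          =O[atTop] (fun k : ℕ => (k : ℝ) ^ (-3 / 2 - ε)) ∨
       (fun k : ℕ => ⨆ p : Fin m × Fin m, ‖P p.1 * T ^ k * P p.2‖)
          =O[atTop] (fun k : ℕ => (k : ℝ) ^ (-1 - ε)) ∨
       (fun k : ℕ => ‖(TT ^ k - TT ^ (k - 1)) * PD‖)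
          =O[atTop] (fun k : ℕ => (k : ℝ) ^ (-1 - ε)) ∨
       (fun k : ℕ => ‖PC * TT ^ k * PD‖) =O[atTop] (fun k : ℕ => (k : ℝ) ^ (-1 / 2 - ε)) ∨
       (fun k : ℕ => ‖TT ^ k * PD * PC‖) =O[atTop] (fun k : ℕ => (k : ℝ) ^ (-1 / 2 - ε)) ∨
       (fun k : ℕ => ‖(TT ^ k - TT ^ (k - 1)) * PD * PC‖)
          =O[atTop] (fun k : ℕ => (k : ℝ) ^ (-3 / 2 - ε)) ∨
       (fun k : ℕ => ‖PC * TT ^ k * PD * PC‖) =O[atTop] (fun k : ℕ => (k : ℝ) ^ (-1 - ε))) →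
      IsClosed (S : Set H) ∧ ‖T - PM‖ < 1 ∧
      ∃ q : ℝ, 0 < q ∧ q < 1 ∧
        (fun k : ℕ => ‖T ^ k - T ^ (k - 1)‖) =O[atTop] (fun k : ℕ => q ^ k) ∧
        (fun k : ℕ => ⨆ i, ‖P i * T ^ k‖) =O[atTop] (fun k : ℕ => q ^ k) ∧
        (fun k : ℕ => ⨆ i, ‖T ^ k * P i‖) =O[atTop] (fun k : ℕ => q ^ k) ∧
        (fun k : ℕ => ⨆ i, ‖(T ^ k - T ^ (k - 1)) * P i‖) =O[atTop] (fun k : ℕ => q ^ k) ∧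
        (fun k : ℕ => ⨆ p : Fin m × Fin m, ‖P p.1 * T ^ k * P p.2‖)
          =O[atTop] (fun k : ℕ => q ^ k) ∧
        (fun k : ℕ => ‖(TT ^ k - TT ^ (k - 1)) * PD‖) =O[atTop] (fun k : ℕ => q ^ k) ∧
        (fun k : ℕ => ‖PC * TT ^ k * PD‖) =O[atTop] (fun k : ℕ => q ^ k) ∧
        (fun k : ℕ => ‖TT ^ k * PD * PC‖) =O[atTop] (fun k : ℕ => q ^ k) ∧
        (fun k : ℕ => ‖(TT ^ k - TT ^ (k - 1)) * PD * PC‖) =O[atTop] (fun k : ℕ => q ^ k) ∧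
        (fun k : ℕ => ‖PC * TT ^ k * PD * PC‖) =O[atTop] (fun k : ℕ => q ^ k) := by
  intro P T PM TT PD PC S
  have : Nonempty (Fin m) := ⟨⟨0, hm⟩⟩
  set l := List.ofFn M with hl
  set N := ⨅ i, M i with hNdef
  have hmem : ∀ i, M i ∈ l := fun i => by rw [hl, List.mem_ofFn]; exact ⟨i, rfl⟩
  have hall : ∀ p : ClosedSubmodule ℝ H → Prop, (∀ K ∈ l, p K) ↔ ∀ i, p (M i) := fun p => by
    simp [hl]
  have hN : ∀ x, x ∈ N ↔ ∀ K ∈ l, x ∈ K := fun x => by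
    rw [hall fun K => x ∈ K, hNdef, ClosedSubmodule.mem_iInf]
  have hT : T = projProd l := cyclicProjection_toSubmodule M
  have hPM : PM = proj N := rfl
  have hS : ∀ K ∈ l, K.toSubmoduleᗮ ≤ S :=
    (hall _).mpr fun i => le_iSup (fun i => (M i).toSubmoduleᗮ) i
  have hSN : S ≤ N.toSubmoduleᗮ := iSup_le fun i =>
    Submodule.orthogonal_le fun _ hy => (hN _).mp hy _ (hmem i)
  -- `Sᗮ` lies in every `M i`; taking complements once more gives the closure of `S`.
  have hNS : IsClosed (S : Set H) → N.toSubmoduleᗮ ≤ S := fun hcl => by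
    have : Sᗮ ≤ N.toSubmodule := fun y hy => (hN y).mpr fun K hK => by
      have h1 := Submodule.orthogonal_le (hS K hK) hy
      rwa [Submodule.orthogonal_orthogonal] at h1
    have h2 := Submodule.orthogonal_le this
    rwa [Submodule.orthogonal_orthogonal_eq_closure, hcl.submodule_topologicalClosure_eq] at h2
  have hiff : IsClosed (S : Set H) ↔ ‖T - PM‖ < 1 := by
    rw [hT, hPM]
    constructor
    · intro hcl
      obtain ⟨C, hC⟩ := exists_norm_le_of_isClosed_iSup M hcl
      exact norm_projProd_sub_lt_one hN fun x hx δ hδ => hC x (hNS hcl hx) δ fun i => hδ _ (hmem i)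
    · intro hlt
      exact isClosed_of_norm_pow_sub_lt_one hN hS hSN (n := 1) (by rwa [pow_one])
  have hTT : ∀ x, TT (ProductSpace.diagL x) = ProductSpace.diagL (T x) :=
    ProductSpace.cyclicProjection_pi_diagL fun i => (M i).toSubmodule
  have hpow := ProductSpace.pow_diagL hTT
  have hdiff : ∀ (k : ℕ) x, (TT ^ k - TT ^ (k - 1)) (ProductSpace.diagL x) =
      ProductSpace.diagL ((T ^ k - T ^ (k - 1)) x) := fun k x => by
    change (TT ^ k) _ - (TT ^ (k - 1)) _ = ProductSpace.diagL ((T ^ k) x - (T ^ (k - 1)) x)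
    rw [hpow, hpow, map_sub]
  -- Maxima become families indexed by the subspaces, and the five product-space conditions become
  -- literally the five conditions on `H`. Since `g` is arbitrary, the same equivalences serve the
  -- hypotheses and the geometric conclusions.
  have e2 : ∀ g : ℕ → ℝ, (fun k : ℕ => ⨆ i, ‖P i * T ^ k‖) =O[atTop] g ↔ _ := fun g =>
    isBigO_iSup_norm_iff
  have e3 : ∀ g : ℕ → ℝ, (fun k : ℕ => ⨆ i, ‖T ^ k * P i‖) =O[atTop] g ↔ _ := fun g =>
    isBigO_iSup_norm_iff
  have e4 : ∀ g : ℕ → ℝ, (fun k : ℕ => ⨆ i, ‖(T ^ k - T ^ (k - 1)) * P i‖) =O[atTop] g ↔ _ :=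
    fun g => isBigO_iSup_norm_iff
  have e5 : ∀ g : ℕ → ℝ, (fun k : ℕ => ⨆ p : Fin m × Fin m, ‖P p.1 * T ^ k * P p.2‖)
      =O[atTop] g ↔ _ := fun g => isBigO_iSup_norm_iff
  have e6 : ∀ g : ℕ → ℝ, (fun k : ℕ => ‖(TT ^ k - TT ^ (k - 1)) * PD‖) =O[atTop] g ↔ _ :=
    fun g => ProductSpace.isBigO_mul_diagonal_iff hm hdiff
  have e7 : ∀ g : ℕ → ℝ, (fun k : ℕ => ‖PC * TT ^ k * PD‖) =O[atTop] g ↔ _ :=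
    fun g => ProductSpace.isBigO_orthogonal_mul_diagonal_iff M hm hpow
  have e8 : ∀ g : ℕ → ℝ, (fun k : ℕ => ‖TT ^ k * PD * PC‖) =O[atTop] g ↔ _ :=
    fun g => ProductSpace.isBigO_mul_diagonal_mul_orthogonal_iff M hm hpow
  have e9 : ∀ g : ℕ → ℝ, (fun k : ℕ => ‖(TT ^ k - TT ^ (k - 1)) * PD * PC‖) =O[atTop] g ↔ _ :=
    fun g => ProductSpace.isBigO_mul_diagonal_mul_orthogonal_iff M hm hdiff
  have e10 : ∀ g : ℕ → ℝ, (fun k : ℕ => ‖PC * TT ^ k * PD * PC‖) =O[atTop] g ↔ _ :=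
    fun g => ProductSpace.isBigO_orthogonal_mul_diagonal_mul_orthogonal_iff M hm hpow
  refine ⟨hiff, fun ε hε h => ?_⟩
  rw [e2, e3, e4, e5, e6, e7, e8, e9, e10, hT] at h
  have hlim : Tendsto (fun k => projProd l ^ k) atTop (nhds (proj N)) := by
    have c1 := tendsto_pow_of_isBigO_sub hN hε
    have c2 := fun h => tendsto_pow_of_isBigO_coproj_mul hN hε ((hall _).mpr h)
    have c3 := fun h => tendsto_pow_of_isBigO_mul_coproj hN hε ((hall _).mpr h)
    have c4 := fun h => tendsto_pow_of_isBigO_sub_mul_coproj hN hε ((hall _).mpr h)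
    have c5 := fun h : ∀ p : Fin m × Fin m,
        (fun k : ℕ => ‖P p.1 * projProd l ^ k * P p.2‖) =O[atTop]
          fun k : ℕ => (k : ℝ) ^ (-1 - ε) => tendsto_pow_of_isBigO_coproj_mul_coproj hN hε
      ((hall _).mpr fun i => (hall _).mpr fun j => h (i, j))
    rcases h with h | h | h | h | h | h | h | h | h | h
    exacts [c1 h, c2 h, c3 h, c4 h, c5 h, c1 h, c2 h, c3 h, c4 h, c5 h]
  obtain ⟨n, hn⟩ := ((tendsto_iff_norm_sub_tendsto_zero.mp hlim).eventually_lt_const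
    one_pos).exists
  have hcl : IsClosed (S : Set H) := isClosed_of_norm_pow_sub_lt_one hN hS hSN hn
  have hlt := hiff.mp hcl
  -- The norm may be 0, while `q` has to be positive.
  set q := max ‖T - PM‖ (1 / 2)
  have hq0 : 0 < q := lt_max_of_lt_right (by norm_num)
  have hq : ‖projProd l - proj N‖ ≤ q := by rw [← hT]; exact le_max_left _ _
  refine ⟨hcl, hlt, q, hq0, max_lt hlt (by norm_num), ?_⟩
  rw [e2, e3, e4, e5, e6, e7, e8, e9, e10, hT]
  have r1 := (isBigO_pow_sub_pow hN hq0 hq).norm_left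
  have r2 := fun i => (isBigO_coproj_mul_pow hN hq (hmem i)).norm_left
  have r3 := fun i => (isBigO_pow_mul_coproj hN hq (hmem i)).norm_left
  have r4 := fun i => ((isBigO_comp_comp (isBigO_pow_sub_pow hN hq0 hq) 1
    (coproj (M i))).congr_left fun k =>
    one_mul ((projProd l ^ k - projProd l ^ (k - 1)) * coproj (M i))).norm_left
  have r5 := fun p : Fin m × Fin m => ((isBigO_comp_comp (isBigO_coproj_mul_pow hN hq (hmem p.1)) 1
    (coproj (M p.2))).congr_left fun k =>
    one_mul (coproj (M p.1) * projProd l ^ k * coproj (M p.2))).norm_left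
  exact ⟨r1, r2, r3, r4, r5, r1, r2, r3, r4, r5⟩
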